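/- For an integer $n\ge 1$ and $d\in\mathbb R$ let $\mathcal M^{\mathbb R}_n(d)$ be the set of real symmetric orthogonal $n\times n$ matrices $S$ for which there are real numbers $a\ge 0$, $b>0$ with $|S_{jj}|=a$ for all $j$, $|S_{jk}|=b$ for all $j\ne k$, and $a/b=d$. For integers $v>k>\lambda\ge 0$, a symmetric $(v,k,\lambda)$-design is a set $\mathcal P$ of $v$ points together with a set of $v$ subsets of $\mathcal P$ (blocks), each containing exactly $k$ points, such that each pair of distinct points is contained in exactly $\lambda$ blocks (the degenerate case $\lambda=0$ is allowed; if $v,k,\lambda$ are not all integers with $v>k>\lambda\ge0$, no such design exists). Theorem 6.2. (i) If $d\in\left(\frac n6-1,\ \frac n4-\frac32\right)$, then $\mathcal M^{\mathbb R}_n(d)$ is empty. (ii) If $d\in\left[\frac n4-\frac32,\ \frac n2-1\right)$, then $\mathcal M^{\mathbb R}_n(d)$ is non-empty if and only if $$q:=\sqrt{\frac n2+\left(\frac n2-1\right)\left(2d+2-\frac n2\right)}$$ is an integer and there exists a symmetric $\left(\frac n2,k,\lambda\right)$-design with $k=\frac n4-\frac q2$ and $\lambda=\frac12(d-q+1)$.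 -/

import Mathlib

/-- A real square matrix is modularly permutation-symmetric (MPS) with moduli `a` and `b` if all its
diagonal entries have modulus `a` and all its off-diagonal entries have modulus `b`. -/
def IsMPSWith {n : ℕ} (S : Matrix (Fin n) (Fin n) ℝ) (a b : ℝ) : Prop :=
  (∀ j, |S j j| = a) ∧ ∀ j k, j ≠ k → |S j k| = b

/-- The set of real symmetric orthogonal MPS matrices of order `n` with nonzero off-diagonal modulus
for which the ratio (diagonal modulus) / (off-diagonal modulus) equals `d`. -/
def realMPS (n : ℕ) (d : ℝ) : Set (Matrix (Fin n) (Fin n) ℝ) :=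
  {S | S ∈ Matrix.orthogonalGroup (Fin n) ℝ ∧ S.IsSymm ∧
    ∃ a b : ℝ, 0 ≤ a ∧ 0 < b ∧ IsMPSWith S a b ∧ a / b = d}

/-- `B` is the set of blocks of a symmetric `(v, k, l)`-design with point set `P`, where
`v > k > l ≥ 0`. The degenerate value `l = 0` is allowed. -/
structure IsSymmetricDesign {P : Type*} [Fintype P] [DecidableEq P]
    (B : Finset (Finset P)) (v k l : ℕ) : Prop where
  k_lt_v : k < v
  l_lt_k : l < k
  card_points : Fintype.card P = v
  card_blocks : B.card = v
  block_size : ∀ b ∈ B, b.card = k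
  pair_count : ∀ x y : P, x ≠ y → (B.filter (fun b => x ∈ b ∧ y ∈ b)).card = l

/-- There exists a symmetric `(v, k, l)`-design. -/
def ExistsSymmetricDesign (v k l : ℕ) : Prop :=
  ∃ B : Finset (Finset (Fin v)), IsSymmetricDesign B v k l

/-! Scale the off-diagonal entries to ±1. If three rows with diagonal entry `d` span a positive
triangle, some signed sum of them has three entries of modulus `d + 2` and odd integers elsewhere.
Comparing with its norm forces `d ≤ n / 6 - 1` (`triangle`). Above that bound, sign switching brings
the matrix to the form `[[A, B], [Bᵀ, -A']]`, where `A` and `A'` have the shape `(d + 1) I - J`.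
Orthogonality makes the two halves equal in size `v = n / 2`, gives the lines of `B` a constant sum
`s` and pairwise inner products `t = 2 (d + 1) - v`, and yields `s ^ 2 = v + (v - 1) t`
(`block_relations`). So `B` is the ±1 incidence matrix of a symmetric design, with `s = -q` after a
choice of sign, and the construction reverses. For (i), `t` is an integer below `-1`, so `t ≤ -2`
and `s ^ 2 ≤ 2 - v < 0`. -/

/-- A symmetric matrix with diagonal entries `±d` and off-diagonal entries `±1` whose rows are
pairwise orthogonal. -/
structure IsScaledMPS {ι : Type*} [Fintype ι] (C : Matrix ι ι ℝ) (d : ℝ) : Prop where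
  symm : ∀ i j, C i j = C j i
  diag : ∀ i, C i i = d ∨ C i i = -d
  off : ∀ i j, i ≠ j → C i j = 1 ∨ C i j = -1
  orth : ∀ i j, i ≠ j → ∑ l, C i l * C j l = 0

/-! ### Switching and negative triangles -/

namespace IsScaledMPS

variable {ι : Type*} [Fintype ι] {C : Matrix ι ι ℝ} {d : ℝ}

lemma neg (h : IsScaledMPS C d) : IsScaledMPS (-C) d where
  symm i j := by simp [h.symm i j]
  diag i := by
    rcases h.diag i with h | h <;> simp [h]
  off i j hij := by
    rcases h.off i j hij with h | h <;> simp [h]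
  orth i j hij := by simpa using h.orth i j hij

lemma switch (h : IsScaledMPS C d) {e : ι → ℝ} (he : ∀ i, e i = 1 ∨ e i = -1) :
    IsScaledMPS (Matrix.of fun i j => e i * e j * C i j) d where
  symm i j := by simp [h.symm i j, mul_comm (e i)]
  diag i := by
    rcases h.diag i with h | h <;> rcases he i with h' | h' <;> simp [h, h']
  off i j hij := by
    rcases h.off i j hij with h | h <;> rcases he i with h' | h' <;> rcases he j with h'' | h'' <;>
      simp [h, h', h'']
  orth i j hij := by
    have h1 : ∀ l, e i * e l * C i l * (e j * e l * C j l) = e i * e j * (C i l * C j l) := by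
      intro l
      rcases he l with h' | h' <;> rw [h'] <;> ring
    simp only [Matrix.of_apply, h1, ← Finset.mul_sum, h.orth i j hij, mul_zero]

lemma submatrix {κ : Type*} [Fintype κ] (h : IsScaledMPS C d) (e : κ ≃ ι) :
    IsScaledMPS (C.submatrix e e) d where
  symm i j := h.symm _ _
  diag i := h.diag _
  off i j hij := h.off _ _ (fun h => hij (e.injective h))
  orth i j hij := by
    have := h.orth (e i) (e j) (fun h => hij (e.injective h))
    rw [← this]
    exact e.sum_comp fun l => C (e i) l * C (e j) l

lemma sum_sq [DecidableEq ι] (h : IsScaledMPS C d) (i : ι) :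
    ∑ l, C i l ^ 2 = d ^ 2 + Fintype.card ι - 1 := by
  have h1 : ∀ l, C i l ^ 2 = 1 + if i = l then d ^ 2 - 1 else 0 := by
    intro l
    split_ifs with hl
    · subst hl
      rcases h.diag i with h | h <;> rw [h] <;> ring
    · rcases h.off i l hl with h | h <;> rw [h] <;> ring
  simp only [h1, Finset.sum_add_distrib, Finset.sum_ite_eq, Finset.mem_univ, if_true,
    Finset.sum_const, Finset.card_univ, nsmul_eq_mul]
  ring

/-- Three rows with equal diagonal entries `d > n / 6 - 1` span a negative triangle. -/
lemma triangle [DecidableEq ι] (h : IsScaledMPS C d) (hd : (Fintype.card ι : ℝ) / 6 - 1 < d)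
    {j k m : ι} (hjk : j ≠ k) (hjm : j ≠ m) (hkm : k ≠ m)
    (hj : C j j = d) (hk : C k k = d) (hm : C m m = d) :
    C j k * C j m * C k m = -1 := by
  by_contra hne
  have hp : C j k * C j m * C k m = 1 := by
    rcases h.off j k hjk with h1 | h1 <;> rcases h.off j m hjm with h2 | h2 <;>
      rcases h.off k m hkm with h3 | h3 <;> simp [h1, h2, h3] at hne ⊢
  have hkj := h.symm k j
  have hmj := h.symm m j
  have hmk := h.symm m k
  -- Positivity of the triangle makes the entries at `j`, `k`, `m` equal to ±(d + 2). Elsewhere a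
  -- sum of three signs is odd, so its square is at least 1.
  have hpt : ∀ l, (1 : ℝ) + (if j = l then (d + 2) ^ 2 - 1 else 0)
      + (if k = l then (d + 2) ^ 2 - 1 else 0) + (if m = l then (d + 2) ^ 2 - 1 else 0)
      ≤ (C j l + C j k * C k l + C j m * C m l) ^ 2 := by
    intro l
    by_cases h1 : j = l
    · subst h1
      rw [if_pos rfl, if_neg hjk.symm, if_neg hjm.symm, hj, hkj, hmj]
      rcases h.off j k hjk with h1 | h1 <;> rcases h.off j m hjm with h2 | h2 <;>
        rw [h1, h2] <;> apply le_of_eq <;> ring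
    by_cases h2 : k = l
    · subst h2
      rw [if_neg h1, if_pos rfl, if_neg hkm.symm, hk, hmk]
      rcases h.off j k hjk with e1 | e1 <;> rcases h.off j m hjm with e2 | e2 <;>
        rcases h.off k m hkm with e3 | e3 <;> rw [e1, e2, e3] at hp ⊢ <;>
        first | (exfalso; norm_num at hp; done) | (apply le_of_eq; ring1)
    by_cases h3 : m = l
    · subst h3
      rw [if_neg h1, if_neg h2, if_pos rfl, hm]
      rcases h.off j k hjk with e1 | e1 <;> rcases h.off j m hjm with e2 | e2 <;>
        rcases h.off k m hkm with e3 | e3 <;> rw [e1, e2, e3] at hp ⊢ <;>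
        first | (exfalso; norm_num at hp; done) | (apply le_of_eq; ring1)
    rw [if_neg h1, if_neg h2, if_neg h3]
    rcases h.off j k hjk with e1 | e1 <;> rcases h.off j m hjm with e2 | e2 <;>
      rcases h.off j l h1 with e3 | e3 <;> rcases h.off k l h2 with e4 | e4 <;>
      rcases h.off m l h3 with e5 | e5 <;> rw [e1, e2, e3, e4, e5] <;> norm_num
  have hsum := Finset.sum_le_sum fun l (_ : l ∈ Finset.univ) => hpt l
  have hr : ∑ l, (C j l + C j k * C k l + C j m * C m l) ^ 2 =
      3 * (d ^ 2 + Fintype.card ι - 1) := by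
    have hjk2 : C j k ^ 2 = 1 := by rcases h.off j k hjk with h | h <;> rw [h] <;> norm_num
    have hjm2 : C j m ^ 2 = 1 := by rcases h.off j m hjm with h | h <;> rw [h] <;> norm_num
    have : ∀ l, (C j l + C j k * C k l + C j m * C m l) ^ 2 = C j l ^ 2 + C k l ^ 2 + C m l ^ 2 +
        2 * C j k * (C j l * C k l) + 2 * C j m * (C j l * C m l) +
        2 * (C j k * C j m) * (C k l * C m l) := by
      intro l
      linear_combination C k l ^ 2 * hjk2 + C m l ^ 2 * hjm2
    simp only [this, Finset.sum_add_distrib, ← Finset.mul_sum, h.orth _ _ hjk, h.orth _ _ hjm,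
      h.orth _ _ hkm, h.sum_sq]
    ring
  rw [hr] at hsum
  simp only [Finset.sum_add_distrib, Finset.sum_ite_eq, Finset.mem_univ, if_true,
    Finset.sum_const, Finset.card_univ, nsmul_eq_mul] at hsum
  linarith

/-- The rows with diagonal entry `d > n / 6 - 1` can be switched so that all off-diagonal entries
between them are `-1`. -/
lemma exists_switch [DecidableEq ι] (h : IsScaledMPS C d)
    (hd : (Fintype.card ι : ℝ) / 6 - 1 < d) :
    ∃ e : ι → ℝ, (∀ i, e i = 1 ∨ e i = -1) ∧
      ∀ i j, C i i = d → C j j = d → i ≠ j → e i * e j * C i j = -1 := by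
  by_cases hex : ∃ o, C o o = d
  · obtain ⟨o, ho⟩ := hex
    -- Switching by the negated row of `o` makes that row `-1`; the triangle `o, i, j` then settles
    -- the remaining entries.
    refine ⟨fun i => if o = i then 1 else -C o i, fun i => ?_, fun i j hi hj hij => ?_⟩
    · dsimp only
      split_ifs with hoi
      · exact Or.inl rfl
      · rcases h.off o i hoi with h | h <;> simp [h]
    · dsimp only
      split_ifs with h1 h2 h2
      · exact absurd (h1.symm.trans h2) hij
      · subst h1
        rcases h.off o j h2 with h | h <;> rw [h] <;> norm_num
      · subst h2
        rw [h.symm i o]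
        rcases h.off o i h1 with h | h <;> rw [h] <;> norm_num
      · have := h.triangle hd h1 h2 hij ho hi hj
        linear_combination this
  · exact ⟨fun _ => 1, fun _ => Or.inl rfl, fun i _ hi => absurd ⟨i, hi⟩ hex⟩

end IsScaledMPS

/-! ### Block form of a scaled matrix -/

namespace IsScaledMPS

/-- If the rows with diagonal entry `d` and those with diagonal entry `-d` are separated, and
switched so that the diagonal blocks are constant off the diagonal, the two blocks have the same
size and the off-diagonal block is the `±1` incidence matrix of a design. -/
lemma block_relations {p m : ℕ} {d : ℝ} {C : Matrix (Fin p ⊕ Fin m) (Fin p ⊕ Fin m) ℝ}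
    (h : IsScaledMPS C d)
    (hP : ∀ i j, C (.inl i) (.inl j) = (d + 1) * (if i = j then 1 else 0) - 1)
    (hM : ∀ i j, C (.inr i) (.inr j) = 1 - (d + 1) * (if i = j then 1 else 0))
    (h3 : 3 ≤ p + m) (hd : d < ((p + m : ℕ) : ℝ) / 2 - 1) :
    p = m ∧ ∃ s : ℝ, (∀ i, ∑ j, C (.inl i) (.inr j) = s) ∧ (∀ j, ∑ i, C (.inl i) (.inr j) = s) ∧
      (∀ i i', i ≠ i' → ∑ j, C (.inl i) (.inr j) * C (.inl i') (.inr j) = 2 * (d + 1) - p) ∧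
      (∀ j j', j ≠ j' → ∑ i, C (.inl i) (.inr j) * C (.inl i) (.inr j') = 2 * (d + 1) - m) ∧
      s ^ 2 = m + (p - 1) * (2 * (d + 1) - p) := by
  have hsw : ∀ i j, C (.inr j) (.inl i) = C (.inl i) (.inr j) := fun i j => h.symm _ _
  have hPP : ∀ i i', i ≠ i' →
      ∑ j, C (.inl i) (.inr j) * C (.inl i') (.inr j) = 2 * (d + 1) - p := by
    intro i i' hne
    have := h.orth (.inl i) (.inl i') (by simpa using hne)
    simp only [Fintype.sum_sum_type, hP] at this
    have e : ∀ l : Fin p, ((d + 1) * (if i = l then 1 else 0) - 1) *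
        ((d + 1) * (if i' = l then 1 else 0) - 1) =
        1 - (d + 1) * (if i = l then 1 else 0) - (d + 1) * (if i' = l then 1 else 0) := by
      intro l
      by_cases h1 : i = l
      · subst h1
        rw [if_pos rfl, if_neg hne.symm]
        ring
      · rw [if_neg h1]
        ring
    simp only [e, Finset.sum_sub_distrib, ← Finset.mul_sum, Finset.sum_ite_eq, Finset.mem_univ,
      if_true, Finset.sum_const, Finset.card_univ, Fintype.card_fin, nsmul_eq_mul] at this
    linarith
  have hMM : ∀ j j', j ≠ j' →
      ∑ i, C (.inl i) (.inr j) * C (.inl i) (.inr j') = 2 * (d + 1) - m := by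
    intro i i' hne
    have := h.orth (.inr i) (.inr i') (by simpa using hne)
    simp only [Fintype.sum_sum_type, hM, hsw] at this
    have e : ∀ l : Fin m, (1 - (d + 1) * (if i = l then 1 else 0)) *
        (1 - (d + 1) * (if i' = l then 1 else 0)) =
        1 - (d + 1) * (if i = l then 1 else 0) - (d + 1) * (if i' = l then 1 else 0) := by
      intro l
      by_cases h1 : i = l
      · subst h1
        rw [if_pos rfl, if_neg hne.symm]
        ring
      · rw [if_neg h1]
        ring
    simp only [e, Finset.sum_sub_distrib, ← Finset.mul_sum, Finset.sum_ite_eq, Finset.mem_univ,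
      if_true, Finset.sum_const, Finset.card_univ, Fintype.card_fin, nsmul_eq_mul] at this
    linarith
  -- The two terms `(d + 1) * B i j` cancel, so every row sum equals every column sum.
  have hPM : ∀ i j, ∑ j, C (.inl i) (.inr j) = ∑ i, C (.inl i) (.inr j) := by
    intro i j
    have := h.orth (.inl i) (.inr j) (by simp)
    simp only [Fintype.sum_sum_type, hP, hM, hsw, sub_mul, mul_sub, one_mul, mul_one,
      Finset.sum_sub_distrib] at this
    simp only [ite_mul, zero_mul, Finset.sum_ite_eq, Finset.mem_univ, if_true, mul_ite, mul_one,
      mul_zero] at this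
    linarith
  have hsq : ∀ i j, i ≠ j → C i j * C i j = 1 := by
    intro i j hij
    rcases h.off i j hij with h | h <;> rw [h] <;> norm_num
  have hd' : 2 * (d + 1) < (p : ℝ) + m := by push_cast at hd; linarith
  have h3' : (3 : ℝ) ≤ (p : ℝ) + m := by exact_mod_cast h3
  -- If one class is empty, two rows of the other give `2 (d + 1) = n`, against `hd`.
  have hp : 0 < p := by
    by_contra h0
    obtain rfl : p = 0 := by omega
    have := hMM ⟨0, by omega⟩ ⟨1, by omega⟩ (by simp)
    simp at this hd'
    linarith
  have hm : 0 < m := by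
    by_contra h0
    obtain rfl : m = 0 := by omega
    have := hPP ⟨0, by omega⟩ ⟨1, by omega⟩ (by simp)
    simp at this hd'
    linarith
  have hrow : ∀ i, ∑ j, C (.inl i) (.inr j) = ∑ j, C (.inl ⟨0, hp⟩) (.inr j) := fun i => by
    rw [hPM i ⟨0, hm⟩, ← hPM]
  have hcol : ∀ j, ∑ i, C (.inl i) (.inr j) = ∑ j, C (.inl ⟨0, hp⟩) (.inr j) := fun j => by
    rw [hPM _ j]
  generalize ∑ j, C (.inl ⟨0, hp⟩) (.inr j) = s at hrow hcol
  have hs1 : s ^ 2 = m + (p - 1) * (2 * (d + 1) - p) := by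
    have e1 : ∑ i, ∑ j, C (.inl ⟨0, hp⟩) (.inr j) * C (.inl i) (.inr j) = s ^ 2 := by
      rw [Finset.sum_comm]
      simp only [← Finset.mul_sum, hcol, ← Finset.sum_mul, hrow]
      ring
    rw [← e1, ← Finset.add_sum_erase _ _ (Finset.mem_univ ⟨0, hp⟩),
      Finset.sum_congr rfl fun i hi => hPP _ i (Finset.ne_of_mem_erase hi).symm]
    simp only [hsq _ _ Sum.inl_ne_inr, Finset.sum_const, Finset.card_univ, Fintype.card_fin,
      Finset.card_erase_of_mem (Finset.mem_univ _), nsmul_eq_mul, Nat.cast_pred hp, mul_one]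
  have hs2 : s ^ 2 = p + (m - 1) * (2 * (d + 1) - m) := by
    have e1 : ∑ j, ∑ i, C (.inl i) (.inr ⟨0, hm⟩) * C (.inl i) (.inr j) = s ^ 2 := by
      rw [Finset.sum_comm]
      simp only [← Finset.mul_sum, hrow, ← Finset.sum_mul, hcol]
      ring
    rw [← e1, ← Finset.add_sum_erase _ _ (Finset.mem_univ ⟨0, hm⟩),
      Finset.sum_congr rfl fun i hi => hMM _ i (Finset.ne_of_mem_erase hi).symm]
    simp only [hsq _ _ Sum.inl_ne_inr, Finset.sum_const, Finset.card_univ, Fintype.card_fin,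
      Finset.card_erase_of_mem (Finset.mem_univ _), nsmul_eq_mul, Nat.cast_pred hm, mul_one]
  refine ⟨?_, s, hrow, hcol, hPP, hMM, hs1⟩
  -- The two evaluations of `s ^ 2` differ by this product, whose second factor is negative by `hd`.
  have : ((p : ℝ) - m) * (2 * (d + 1) - (p + m)) = 0 := by linear_combination hs2 - hs1
  rcases mul_eq_zero.1 this with h | h
  · exact_mod_cast sub_eq_zero.1 h
  · linarith

/-- The part of a scaled MPS matrix with `n / 6 - 1 < d < n / 2 - 1` that joins the two halves of
its index set. -/
lemma exists_block {n : ℕ} {d : ℝ} {C : Matrix (Fin n) (Fin n) ℝ} (h : IsScaledMPS C d)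
    (h3 : 3 ≤ n) (hd : (n : ℝ) / 6 - 1 < d) (hd' : d < (n : ℝ) / 2 - 1) :
    ∃ (v : ℕ) (B : Matrix (Fin v) (Fin v) ℝ) (s : ℝ), n = v + v ∧ s ≤ 0 ∧
      (∀ i j, B i j = 1 ∨ B i j = -1) ∧ (∀ i, ∑ j, B i j = s) ∧ (∀ j, ∑ i, B i j = s) ∧
      (∀ i i', i ≠ i' → ∑ j, B i j * B i' j = 2 * (d + 1) - v) ∧
      (∀ j j', j ≠ j' → ∑ i, B i j * B i j' = 2 * (d + 1) - v) ∧
      s ^ 2 = v + (v - 1) * (2 * (d + 1) - v) := by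
  classical
  obtain ⟨e, he, he'⟩ := h.exists_switch (by simpa using hd)
  -- Rows with diagonal entry `-d` have diagonal entry `d` in `-C`.
  obtain ⟨f, hf, hf'⟩ := h.neg.exists_switch (by simpa using hd)
  set g : Fin n → ℝ := fun i => if C i i = d then e i else f i with hg
  have hg1 : ∀ i, g i = 1 ∨ g i = -1 := by
    intro i
    simp only [hg]
    split_ifs
    exacts [he i, hf i]
  obtain ⟨p, ⟨eP⟩⟩ : ∃ p, Nonempty (Fin p ≃ {i // C i i = d}) :=
    ⟨_, ⟨(Fintype.equivFin _).symm⟩⟩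
  obtain ⟨m, ⟨eM⟩⟩ : ∃ m, Nonempty (Fin m ≃ {i // ¬ C i i = d}) :=
    ⟨_, ⟨(Fintype.equivFin _).symm⟩⟩
  let E : Fin p ⊕ Fin m ≃ Fin n := (Equiv.sumCongr eP eM).trans (Equiv.sumCompl _)
  have hcard : p + m = n := by simpa using Fintype.card_congr E
  have hEP : ∀ i, E (.inl i) = (eP i : Fin n) := fun i => rfl
  have hEM : ∀ i, E (.inr i) = (eM i : Fin n) := fun i => rfl
  have hG := (h.switch hg1).submatrix E
  have hgg : ∀ i, g i * g i = 1 := by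
    intro i
    rcases hg1 i with h | h <;> rw [h] <;> norm_num
  obtain ⟨hpm, s, hrow, hcol, hPP, hMM, hs⟩ := hG.block_relations (p := p) (m := m) (d := d)
    (by
      intro i j
      simp only [Matrix.submatrix_apply, Matrix.of_apply, hEP]
      split_ifs with hij
      · subst hij
        rw [hgg, (eP i).2]
        ring
      · have := he' (eP i) (eP j) (eP i).2 (eP j).2
          (fun h => hij (eP.injective (Subtype.ext h)))
        simp only [hg, if_pos (eP i).2, if_pos (eP j).2, this]
        ring)
    (by
      intro i j
      have hi := (h.diag (eM i)).resolve_left (eM i).2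
      have hj := (h.diag (eM j)).resolve_left (eM j).2
      simp only [Matrix.submatrix_apply, Matrix.of_apply, hEM]
      split_ifs with hij
      · subst hij
        rw [hgg, hi]
        ring
      · have := hf' (eM i) (eM j) (by simp [hi]) (by simp [hj])
          (fun h => hij (eM.injective (Subtype.ext h)))
        simp only [hg, if_neg (eM i).2, if_neg (eM j).2]
        rw [Matrix.neg_apply] at this
        linear_combination -this)
    (by omega) (by rw [hcard]; exact hd')
  subst hpm
  set B : Matrix (Fin p) (Fin p) ℝ := Matrix.of fun i j =>
    (Matrix.of fun i j => g i * g j * C i j).submatrix E E (.inl i) (.inr j)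
  have hB1 : ∀ i j, B i j = 1 ∨ B i j = -1 := fun i j => hG.off (.inl i) (.inr j) (by simp)
  change ∀ i, ∑ j, B i j = s at hrow
  change ∀ j, ∑ i, B i j = s at hcol
  change ∀ i i', i ≠ i' → ∑ j, B i j * B i' j = _ at hPP
  change ∀ j j', j ≠ j' → ∑ i, B i j * B i j' = _ at hMM
  -- Negating `B` complements the design; `s ≤ 0` selects the one with `k ≤ v / 2`.
  rcases le_total s 0 with h0 | h0
  · exact ⟨p, B, s, hcard.symm, h0, hB1, hrow, hcol, hPP, hMM, hs⟩
  · refine ⟨p, -B, -s, hcard.symm, by linarith, fun i j => ?_, fun i => ?_, fun j => ?_,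
      fun i i' hi => ?_, fun j j' hj => ?_, by rw [neg_sq]; exact hs⟩
    · rcases hB1 i j with h | h <;> simp [h]
    · simpa using hrow i
    · simpa using hcol j
    · simpa using hPP i i' hi
    · simpa using hMM j j' hj

end IsScaledMPS

/-! ### Sign matrices and symmetric designs -/

/-- A `±1` matrix with constant line sums and constant inner products of distinct lines yields a
symmetric design. -/
lemma exists_design_of_signs {v : ℕ} {B : Matrix (Fin v) (Fin v) ℝ} {s t : ℝ}
    (hB : ∀ i j, B i j = 1 ∨ B i j = -1) (hrow : ∀ i, ∑ j, B i j = s) (hcol : ∀ j, ∑ i, B i j = s)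
    (hrr : ∀ i i', i ≠ i' → ∑ j, B i j * B i' j = t)
    (hcc : ∀ j j', j ≠ j' → ∑ i, B i j * B i j' = t) (hv : 2 ≤ v) (hs : s < v) (ht : t < v) :
    ∃ k l : ℕ, (k : ℝ) = (v + s) / 2 ∧ (l : ℝ) = (v + 2 * s + t) / 4 ∧
      ExistsSymmetricDesign v k l := by
  classical
  set blk : Fin v → Finset (Fin v) := fun j => Finset.univ.filter fun i => B i j = 1 with hblk
  have hmem : ∀ i j, i ∈ blk j ↔ B i j = 1 := by simp [hblk]
  have hind : ∀ i j, (if B i j = 1 then (1 : ℝ) else 0) = (1 + B i j) / 2 := by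
    intro i j
    rcases hB i j with h | h <;> rw [h] <;> norm_num
  have hsize : ∀ j, ((blk j).card : ℝ) = (v + s) / 2 := by
    intro j
    rw [hblk, Finset.card_filter]
    push_cast
    simp only [hind]
    rw [← Finset.sum_div, Finset.sum_add_distrib, hcol]
    simp
  have hpair : ∀ x y, x ≠ y →
      ((Finset.univ.filter fun j => x ∈ blk j ∧ y ∈ blk j).card : ℝ) = (v + 2 * s + t) / 4 := by
    intro x y hxy
    rw [Finset.card_filter]
    push_cast
    have e : ∀ j, (if x ∈ blk j ∧ y ∈ blk j then (1 : ℝ) else 0) =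
        (1 + B x j + B y j + B x j * B y j) / 4 := by
      intro j
      simp only [hmem]
      rcases hB x j with h | h <;> rcases hB y j with h' | h' <;> simp only [h, h'] <;> norm_num
    simp only [e]
    rw [← Finset.sum_div, Finset.sum_add_distrib, Finset.sum_add_distrib, Finset.sum_add_distrib,
      hrow, hrow, hrr x y hxy]
    simp
    ring
  -- Equal blocks would mean equal columns, with inner product `v > t`.
  have hinj : Function.Injective blk := by
    intro j j' hjj
    by_contra hne
    have h1 := hcc j j' hne
    have h2 : ∀ i, B i j * B i j' = 1 := by
      intro i
      have h3 : B i j = 1 ↔ B i j' = 1 := by rw [← hmem, ← hmem, hjj]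
      rcases hB i j with h | h <;> rcases hB i j' with h' | h' <;> rw [h, h'] at h3 ⊢ <;>
        first | (exfalso; norm_num at h3; done) | norm_num
    simp only [h2] at h1
    simp at h1
    linarith
  let i0 : Fin v := ⟨0, by omega⟩
  let i1 : Fin v := ⟨1, by omega⟩
  have h01 : i0 ≠ i1 := by simp [i0, i1]
  refine ⟨(blk i0).card, (Finset.univ.filter fun j => i0 ∈ blk j ∧ i1 ∈ blk j).card, hsize _,
    hpair _ _ h01, Finset.univ.image blk, ?_, ?_, Fintype.card_fin v, ?_, ?_, ?_⟩
  · rw [← @Nat.cast_lt ℝ, hsize]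
    linarith
  · rw [← @Nat.cast_lt ℝ, hsize, hpair _ _ h01]
    linarith
  · rw [Finset.card_image_of_injective _ hinj, Finset.card_univ, Fintype.card_fin]
  · intro b hb
    obtain ⟨j, -, rfl⟩ := Finset.mem_image.1 hb
    rw [← @Nat.cast_inj ℝ, hsize, hsize]
  · intro x y hxy
    rw [Finset.filter_image, Finset.card_image_of_injective _ hinj, ← @Nat.cast_inj ℝ,
      hpair _ _ hxy, hpair _ _ h01]

/-- The incidence matrix of a symmetric design; the dual of the design is a symmetric design. -/
lemma ExistsSymmetricDesign.exists_incidence {v k l : ℕ} (h : ExistsSymmetricDesign v k l) :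
    ∃ N : Matrix (Fin v) (Fin v) ℝ, (∀ i j, N i j = 0 ∨ N i j = 1) ∧ (∀ i, ∑ j, N i j = k) ∧
      (∀ j, ∑ i, N i j = k) ∧ (∀ i i', i ≠ i' → ∑ j, N i j * N i' j = l) ∧
      (∀ j j', j ≠ j' → ∑ i, N i j * N i j' = l) := by
  classical
  obtain ⟨Bl, h⟩ := h
  have hlk := h.l_lt_k
  let e : Fin v ≃ Bl := (Bl.equivFinOfCardEq h.card_blocks).symm
  set N : Matrix (Fin v) (Fin v) ℝ := Matrix.of fun i j => if i ∈ (e j : Finset (Fin v)) then 1 else 0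
    with hN
  have hN01 : ∀ i j, N i j = 0 ∨ N i j = 1 := by
    intro i j
    simp only [hN, Matrix.of_apply]
    split_ifs <;> simp
  have hNN : ∀ i j, N i j * N i j = N i j := by
    intro i j
    rcases hN01 i j with h | h <;> rw [h] <;> norm_num
  have hcol : ∀ j, ∑ i, N i j = k := by
    intro j
    have := h.block_size (e j) (e j).2
    simp [hN, this]
  have hrr : ∀ i i', i ≠ i' → ∑ j, N i j * N i' j = l := by
    intro i i' hne
    rw [← h.pair_count i i' hne, Finset.card_filter]
    push_cast
    rw [← Finset.sum_coe_sort Bl, ← e.sum_comp]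
    refine Finset.sum_congr rfl fun j _ => ?_
    simp only [hN, Matrix.of_apply, ite_and]
    split_ifs <;> simp
  have hk0 : (0 : ℝ) < k := by exact_mod_cast (by omega : 0 < k)
  have hlk' : (l : ℝ) < k := by exact_mod_cast hlk
  have hv1 : (1 : ℝ) ≤ v := by exact_mod_cast (by have := h.k_lt_v; omega : 1 ≤ v)
  -- Flag counting: summing the inner products of row `i` with all rows gives `r (k - 1) = l (v -
  -- 1)`.
  have hrow' : ∀ i, (∑ j, N i j) * (k - 1) = l * (v - 1) := by
    intro i
    have e1 : ∑ i', ∑ j, N i j * N i' j = (∑ j, N i j) * k := by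
      rw [Finset.sum_comm]
      simp only [← Finset.mul_sum, hcol, ← Finset.sum_mul]
    rw [← Finset.add_sum_erase _ _ (Finset.mem_univ i),
      Finset.sum_congr rfl fun i' hi => hrr _ i' (Finset.ne_of_mem_erase hi).symm] at e1
    simp only [hNN, Finset.sum_const, Finset.card_univ, Fintype.card_fin,
      Finset.card_erase_of_mem (Finset.mem_univ _), nsmul_eq_mul] at e1
    rw [Nat.cast_pred (by have := h.k_lt_v; omega)] at e1
    linear_combination -e1
  have htot : ∑ i, ∑ j, N i j = v * k := by
    exact Finset.sum_comm.trans (by simp [hcol])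
  have hrow : ∀ i, ∑ j, N i j = k := by
    -- For `k = 1` the relation `hrow'` does not determine the row sums. There the blocks are
    -- distinct singletons, so each row sum is at most 1, and the total `v` forces equality.
    rcases Nat.lt_or_ge 1 k with hk | hk
    · have hk' : (k : ℝ) - 1 ≠ 0 := by
        have : (1 : ℝ) < k := by exact_mod_cast hk
        linarith
      have hconst : ∀ i, ∑ j, N i j = l * (v - 1) / (k - 1) := fun i => by
        rw [eq_div_iff hk', hrow']
      intro i
      simp only [hconst] at htot ⊢
      simp only [Finset.sum_const, Finset.card_univ, Fintype.card_fin, nsmul_eq_mul] at htot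
      exact mul_left_cancel₀ (by linarith) htot
    · obtain rfl : k = 1 := by omega
      have hle : ∀ i, ∑ j, N i j ≤ 1 := by
        intro i
        have : (Finset.univ.filter fun j => i ∈ (e j : Finset (Fin v))).card ≤ 1 := by
          refine Finset.card_le_one.2 fun a ha b hb => ?_
          simp only [Finset.mem_filter, Finset.mem_univ, true_and] at ha hb
          obtain ⟨x, hx⟩ := Finset.card_eq_one.1 (h.block_size _ (e a).2)
          obtain ⟨y, hy⟩ := Finset.card_eq_one.1 (h.block_size _ (e b).2)
          apply e.injective
          apply Subtype.ext
          rw [hx, hy]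
          rw [hx, Finset.mem_singleton] at ha
          rw [hy, Finset.mem_singleton] at hb
          rw [← ha, ← hb]
        simp only [hN, Matrix.of_apply, Finset.sum_boole]
        exact_mod_cast this
      intro i
      rw [Nat.cast_one]
      refine (Finset.sum_eq_sum_iff_of_le fun i _ => hle i).1 ?_ i (Finset.mem_univ i)
      rw [htot]
      simp
  refine ⟨N, hN01, hrow, hcol, hrr, ?_⟩
  set J : Matrix (Fin v) (Fin v) ℝ := Matrix.of fun _ _ => 1 with hJ
  have hkl : (k : ℝ) * (l / k) = l := mul_div_cancel₀ _ hk0.ne'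
  -- `N Nᵀ = (k - l) I + l J` and `N J = k J` give a right inverse of `N`. It is also a left
  -- inverse, which yields the column inner products.
  have hX : N * ((k - l : ℝ)⁻¹ • (N.transpose - ((l : ℝ) / k) • J)) = 1 := by
    ext i j
    have e1 : ∀ x, N i x * ((k - l : ℝ)⁻¹ * (N j x - l / k * 1)) =
        (k - l : ℝ)⁻¹ * (N i x * N j x - N i x * (l / k)) := fun x => by ring
    simp only [Matrix.smul_apply, Matrix.sub_apply, Matrix.mul_apply, Matrix.transpose_apply, hJ,
      Matrix.of_apply, smul_eq_mul, e1]
    rw [← Finset.mul_sum, Finset.sum_sub_distrib, ← Finset.sum_mul, hrow, hkl]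
    by_cases hij : i = j
    · subst hij
      simp only [hNN, hrow, Matrix.one_apply_eq]
      exact inv_mul_cancel₀ (by linarith)
    · rw [hrr i j hij, Matrix.one_apply_ne hij]
      simp
  rw [mul_eq_one_comm] at hX
  intro j j' hne
  have := congrFun (congrFun hX j) j'
  have e1 : ∀ x, (k - l : ℝ)⁻¹ * (N x j - l / k * 1) * N x j' =
      (k - l : ℝ)⁻¹ * (N x j * N x j' - N x j' * (l / k)) := fun x => by ring
  simp only [Matrix.smul_apply, Matrix.sub_apply, Matrix.mul_apply, Matrix.transpose_apply, hJ,
    Matrix.of_apply, smul_eq_mul, Matrix.one_apply_ne hne, e1] at this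
  rw [← Finset.mul_sum, Finset.sum_sub_distrib, ← Finset.sum_mul, hcol, hkl, mul_eq_zero] at this
  rcases this with h | h
  · exact absurd h (inv_ne_zero (by linarith))
  · linarith

/-! ### Normalisation and reconstruction -/

lemma isScaledMPS_of_mem_realMPS {n : ℕ} {d : ℝ} {S : Matrix (Fin n) (Fin n) ℝ}
    (h : S ∈ realMPS n d) : 0 ≤ d ∧ ∃ C : Matrix (Fin n) (Fin n) ℝ, IsScaledMPS C d := by
  obtain ⟨ho, hsymm, a, b, ha, hb, ⟨hdiag, hoff⟩, rfl⟩ := h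
  refine ⟨by positivity, b⁻¹ • S, fun i j => ?_, fun i => ?_, fun i j hij => ?_,
    fun i j hij => ?_⟩
  · simp [hsymm.apply i j]
  · rcases (abs_eq ha).1 (hdiag i) with h | h <;> simp [h, div_eq_inv_mul]
  · rcases (abs_eq hb.le).1 (hoff i j hij) with h | h <;> simp [h, hb.ne']
  · have := congrFun (congrFun ((Matrix.mem_orthogonalGroup_iff _ _).1 ho) i) j
    rw [Matrix.mul_apply, Matrix.one_apply_ne hij] at this
    simp only [Matrix.transpose_apply] at this
    have e : ∀ l, (b⁻¹ • S) i l * (b⁻¹ • S) j l = b⁻¹ * b⁻¹ * (S i l * S j l) := by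
      intro l
      simp only [Matrix.smul_apply, smul_eq_mul]
      ring
    simp only [e, ← Finset.mul_sum, this, mul_zero]

lemma IsScaledMPS.exists_mem_realMPS {n : ℕ} {d : ℝ} {C : Matrix (Fin n) (Fin n) ℝ}
    (h : IsScaledMPS C d) (hd : 0 ≤ d) (hn : 2 ≤ n) : ∃ S, S ∈ realMPS n d := by
  have hn' : (2 : ℝ) ≤ n := by exact_mod_cast hn
  have hc : 0 < d ^ 2 + n - 1 := by nlinarith [sq_nonneg d]
  -- The common norm of the rows, by `sum_sq`.
  set r := Real.sqrt (d ^ 2 + n - 1) with hr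
  have hr0 : 0 < r := Real.sqrt_pos.2 hc
  have hrr : r ^ 2 = d ^ 2 + n - 1 := Real.sq_sqrt hc.le
  refine ⟨r⁻¹ • C, ?_, ?_, r⁻¹ * d, r⁻¹, by positivity, by positivity, ⟨fun j => ?_,
    fun j k hjk => ?_⟩, by field_simp⟩
  · rw [Matrix.mem_orthogonalGroup_iff]
    ext i j
    simp only [Matrix.mul_apply, Matrix.transpose_apply, Matrix.smul_apply, smul_eq_mul]
    have e : ∀ l, r⁻¹ * C i l * (r⁻¹ * C j l) = (r ^ 2)⁻¹ * (C i l * C j l) := by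
      intro l
      field_simp
    simp only [e, ← Finset.mul_sum]
    by_cases hij : i = j
    · subst hij
      simp only [← sq, h.sum_sq, Fintype.card_fin, Matrix.one_apply_eq, hrr]
      exact inv_mul_cancel₀ hc.ne'
    · rw [h.orth i j hij, Matrix.one_apply_ne hij, mul_zero]
  · ext i j
    simp [h.symm i j]
  · rcases h.diag j with h | h <;> simp [h, abs_of_pos hr0, abs_of_nonneg hd]
  · rcases h.off j k hjk with h | h <;> simp [h, abs_of_pos hr0]

/-- A `±1` matrix with constant line sums and suitable inner products of distinct lines is the
off-diagonal block of a scaled MPS matrix. -/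
lemma exists_isScaledMPS_of_signs {v : ℕ} {B : Matrix (Fin v) (Fin v) ℝ} {s d : ℝ}
    (hB : ∀ i j, B i j = 1 ∨ B i j = -1) (hrow : ∀ i, ∑ j, B i j = s) (hcol : ∀ j, ∑ i, B i j = s)
    (hrr : ∀ i i', i ≠ i' → ∑ j, B i j * B i' j = 2 * (d + 1) - v)
    (hcc : ∀ j j', j ≠ j' → ∑ i, B i j * B i j' = 2 * (d + 1) - v) :
    ∃ C : Matrix (Fin (v + v)) (Fin (v + v)) ℝ, IsScaledMPS C d := by
  let A : Matrix (Fin v) (Fin v) ℝ := Matrix.of fun i j => (d + 1) * (if i = j then 1 else 0) - 1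
  have hA : ∀ i j, A i j = (d + 1) * (if i = j then 1 else 0) - 1 := fun _ _ => rfl
  have hAsymm : ∀ i j, A i j = A j i := fun i j => by simp only [hA, eq_comm]
  have hAoff : ∀ i j, i ≠ j → A i j = -1 := fun i j hij => by simp [hA, hij]
  have hAdiag : ∀ i, A i i = d := fun i => by simp [hA]
  have hAA : ∀ i j, i ≠ j → ∑ l, A i l * A j l = v - 2 * (d + 1) := by
    intro i i' hne
    have e : ∀ l : Fin v, A i l * A i' l =
        1 - (d + 1) * (if i = l then 1 else 0) - (d + 1) * (if i' = l then 1 else 0) := by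
      intro l
      simp only [hA]
      by_cases h1 : i = l
      · subst h1
        rw [if_pos rfl, if_neg hne.symm]
        ring
      · rw [if_neg h1]
        ring
    simp only [e, Finset.sum_sub_distrib, ← Finset.mul_sum, Finset.sum_ite_eq, Finset.mem_univ,
      if_true, Finset.sum_const, Finset.card_univ, Fintype.card_fin, nsmul_eq_mul]
    ring
  -- Equal row and column sums make this agree with `hBA`, so the mixed inner products of the block
  -- matrix cancel.
  have hAB : ∀ i j, ∑ l, A i l * B l j = (d + 1) * B i j - s := by
    intro i j
    simp only [hA, sub_mul, one_mul, Finset.sum_sub_distrib, hcol, mul_assoc, ← Finset.mul_sum,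
      ite_mul, zero_mul, Finset.sum_ite_eq, Finset.mem_univ, if_true]
  have hBA : ∀ i j, ∑ l, A j l * B i l = (d + 1) * B i j - s := by
    intro i j
    simp only [hA, sub_mul, one_mul, Finset.sum_sub_distrib, hrow, mul_assoc, ← Finset.mul_sum,
      ite_mul, zero_mul, Finset.sum_ite_eq, Finset.mem_univ, if_true]
  have hC : IsScaledMPS (Matrix.fromBlocks A B B.transpose (-A)) d := by
    refine ⟨?_, ?_, ?_, ?_⟩
    · rintro (i | i) (j | j) <;> simp [hAsymm i j]
    · rintro (i | i) <;> simp [hAdiag]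
    · rintro (i | i) (j | j) hij
      · simp [hAoff i j (by simpa using hij)]
      · exact hB i j
      · exact hB j i
      · simp [hAoff i j (by simpa using hij)]
    · rintro (i | i) (j | j) hij <;>
        simp only [Fintype.sum_sum_type, Matrix.fromBlocks_apply₁₁, Matrix.fromBlocks_apply₁₂,
          Matrix.fromBlocks_apply₂₁, Matrix.fromBlocks_apply₂₂, Matrix.transpose_apply,
          Matrix.neg_apply, mul_neg, neg_mul, Finset.sum_neg_distrib]
      · rw [hAA i j (by simpa using hij), hrr i j (by simpa using hij)]
        ring
      · rw [hAB, Finset.sum_congr rfl fun l _ => mul_comm (B i l) (A j l), hBA]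
        ring
      · rw [Finset.sum_congr rfl fun l _ => mul_comm (B l i) (A j l), hAB, hBA]
        ring
      · rw [hAA i j (by simpa using hij), hcc i j (by simpa using hij)]
        ring
  exact ⟨_, hC.submatrix finSumFinEquiv.symm⟩

/-! ### Designs versus MPS matrices -/

/-- Serves the borderline case `n = 6`, `d = 0`, where `d = n / 6 - 1` and the triangle argument
fails. -/
lemma existsSymmetricDesign_three_one_zero : ExistsSymmetricDesign 3 1 0 :=
  ⟨{{0}, {1}, {2}}, by norm_num, by norm_num, by simp, by decide, by decide, by decide⟩

/-- Every real MPS matrix with `n / 6 - 1 < d < n / 2 - 1` comes from a symmetric design. -/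
lemma exists_design_of_mem_realMPS {n : ℕ} {d : ℝ} {S : Matrix (Fin n) (Fin n) ℝ}
    (h : S ∈ realMPS n d) (hd : (n : ℝ) / 6 - 1 < d) (hd' : d < (n : ℝ) / 2 - 1) :
    ∃ (v k l : ℕ) (s : ℝ), n = v + v ∧ s ≤ 0 ∧ s ^ 2 = v + (v - 1) * (2 * (d + 1) - v) ∧
      (k : ℝ) = (v + s) / 2 ∧ (l : ℝ) = (v + 2 * s + (2 * (d + 1) - v)) / 4 ∧
      ExistsSymmetricDesign v k l := by
  obtain ⟨hd0, C, hC⟩ := isScaledMPS_of_mem_realMPS h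
  have h3 : 3 ≤ n := by
    have : (2 : ℝ) < n := by linarith
    exact_mod_cast this
  obtain ⟨v, B, s, rfl, hs0, hB, hrow, hcol, hrr, hcc, hs⟩ := hC.exists_block h3 hd hd'
  have hv : 2 ≤ v := by omega
  have hv' : (2 : ℝ) ≤ v := by exact_mod_cast hv
  push_cast at hd'
  obtain ⟨k, l, hk, hl, hD⟩ := exists_design_of_signs hB hrow hcol hrr hcc hv (by linarith)
    (by linarith)
  exact ⟨v, k, l, s, rfl, hs0, hs, hk, hl, hD⟩

/-- The lines of `2 N - J` have inner products `4 l - 4 k + v`; `hkl` equates this with the required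
`2 (d + 1) - v`. -/
lemma ExistsSymmetricDesign.exists_mem_realMPS {v k l : ℕ} {d : ℝ}
    (h : ExistsSymmetricDesign v k l) (hd : 0 ≤ d) (hkl : 2 * (d + 1) = 4 * l - 4 * k + 2 * v) :
    ∃ S, S ∈ realMPS (v + v) d := by
  have hv : 1 ≤ v := by
    obtain ⟨Bl, h⟩ := h
    have := h.k_lt_v
    omega
  obtain ⟨N, hN, hrow, hcol, hrr, hcc⟩ := h.exists_incidence
  have e : ∀ x y : ℝ, (2 * x - 1) * (2 * y - 1) = 4 * (x * y) - 2 * x - 2 * y + 1 := by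
    intro x y
    ring
  obtain ⟨C, hC⟩ := exists_isScaledMPS_of_signs (B := Matrix.of fun i j => 2 * N i j - 1)
    (s := 2 * k - v) (d := d)
    (fun i j => by rcases hN i j with h | h <;> simp [h]; norm_num)
    (fun i => by simp [Finset.sum_sub_distrib, ← Finset.mul_sum, hrow])
    (fun j => by simp [Finset.sum_sub_distrib, ← Finset.mul_sum, hcol])
    (fun i i' hi => by
      simp only [Matrix.of_apply, e, Finset.sum_add_distrib, Finset.sum_sub_distrib,
        ← Finset.mul_sum, hrow, hrr i i' hi]
      simp
      linarith)
    (fun j j' hj => by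
      simp only [Matrix.of_apply, e, Finset.sum_add_distrib, Finset.sum_sub_distrib,
        ← Finset.mul_sum, hcol, hcc j j' hj]
      simp
      linarith)
  exact hC.exists_mem_realMPS hd (by omega)

theorem theorem6p2 (n : ℕ) (d q : ℝ)
    (hq : q = Real.sqrt ((n : ℝ) / 2 + ((n : ℝ) / 2 - 1) * (2 * d + 2 - (n : ℝ) / 2))) :
    (d ∈ Set.Ioo ((n : ℝ) / 6 - 1) ((n : ℝ) / 4 - 3 / 2) →
      ¬ ∃ S : Matrix (Fin n) (Fin n) ℝ, S ∈ realMPS n d) ∧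
    (d ∈ Set.Ico ((n : ℝ) / 4 - 3 / 2) ((n : ℝ) / 2 - 1) →
      ((∃ S : Matrix (Fin n) (Fin n) ℝ, S ∈ realMPS n d) ↔
        (∃ z : ℤ, q = (z : ℝ)) ∧
        ∃ v k l : ℕ, (v : ℝ) = (n : ℝ) / 2 ∧ (k : ℝ) = (n : ℝ) / 4 - q / 2 ∧
          (l : ℝ) = (d - q + 1) / 2 ∧ ExistsSymmetricDesign v k l)) := by
  refine ⟨?_, ?_⟩
  · rintro ⟨h1, h2⟩ ⟨S, hS⟩
    obtain ⟨v, k, l, s, rfl, hs0, hs, hk, hl, hD⟩ :=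
      exists_design_of_mem_realMPS hS h1 (by linarith)
    push_cast at h1 h2
    have hv : (3 : ℝ) < v := by linarith
    have hint : 2 * (d + 1) - v = ((4 * l - 4 * k + v : ℤ) : ℝ) := by
      push_cast
      linarith
    have ht : (4 * l - 4 * k + v : ℤ) < -1 := by
      rw [← @Int.cast_lt ℝ, ← hint]
      push_cast
      linarith
    have ht' : 2 * (d + 1) - v ≤ -2 := by
      rw [hint]
      exact_mod_cast (by omega : (4 * l - 4 * k + v : ℤ) ≤ -2)
    nlinarith [sq_nonneg s]
  · rintro ⟨h1, h2⟩
    constructor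
    · rintro ⟨S, hS⟩
      by_cases hd : (n : ℝ) / 6 - 1 < d
      · obtain ⟨v, k, l, s, rfl, hs0, hs, hk, hl, hD⟩ := exists_design_of_mem_realMPS hS hd h2
        have hqs : q = -s := by
          rw [hq, ← Real.sqrt_sq (neg_nonneg.2 hs0), neg_sq, hs]
          congr 1
          push_cast
          ring
        refine ⟨⟨v - 2 * k, ?_⟩, v, k, l, ?_, ?_, ?_, hD⟩
        · push_cast
          linarith
        all_goals
          push_cast
          linarith
      -- Here `n / 4 - 3 / 2 ≤ d ≤ n / 6 - 1` gives `n ≤ 6`, while `0 ≤ d` gives `n ≥ 6`.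
      · have hd0 := (isScaledMPS_of_mem_realMPS hS).1
        push Not at hd
        have hn : (n : ℝ) = 6 := by linarith
        have hd1 : d = 0 := by linarith
        have hq1 : q = 1 := by
          rw [hq, hn, hd1]
          norm_num
        refine ⟨⟨1, by simp [hq1]⟩, 3, 1, 0, ?_, ?_, ?_, existsSymmetricDesign_three_one_zero⟩
        all_goals
          simp only [hn, hq1, hd1]
          norm_num
    · rintro ⟨-, v, k, l, hv, hk, hl, hD⟩
      obtain rfl : n = v + v := by
        have : (n : ℝ) = ((v + v : ℕ) : ℝ) := by
          push_cast
          linarith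
        exact_mod_cast this
      obtain ⟨Bl, hBl⟩ := hD
      have hkv := hBl.k_lt_v
      have hlk := hBl.l_lt_k
      have hv2 : (2 : ℝ) ≤ v := by exact_mod_cast (by omega : 2 ≤ v)
      push_cast at hk h1 h2
      have hdi : d = ((2 * l + v - 2 * k - 1 : ℤ) : ℝ) := by
        push_cast
        linarith
      -- Since `v ≥ 2`, the lower bound on `d` is at least `-1 / 2`, and `d` is an integer.
      have hd0 : 0 ≤ d := by
        have : (-1 : ℝ) < d := by linarith
        rw [hdi] at this ⊢
        have h' : (-1 : ℤ) < 2 * l + v - 2 * k - 1 := by exact_mod_cast this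
        exact_mod_cast (by omega : (0 : ℤ) ≤ 2 * l + v - 2 * k - 1)
      exact ExistsSymmetricDesign.exists_mem_realMPS ⟨Bl, hBl⟩ hd0 (by linarith)
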